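/- Let $d\ge 1$ and let $X\subset\mathbb R^d$ be a non-empty compact set with $\overline{\operatorname{int}X}=X$ such that $X$ is convex, or $\partial X$ is smooth, or $X$ satisfies the cone condition (there are a fixed opening angle and a fixed length such that every point of $\partial X$ is the vertex of an open cone of that angle and length contained in $\operatorname{int}X$). A non-autonomous conformal iterated function system $\Phi$ on $X$ is a sequence of families of maps $\Phi^{(j)}=(\phi^{(j)}_i:X\to X)_{i\in I^{(j)}}$, $j\ge1$, with non-empty countable index sets $I^{(j)}$, such that: (a) $\phi^{(j)}_i(\operatorname{int}X)\cap\phi^{(j)}_{i'}(\operatorname{int}X)=\emptyset$ for all $j$ and all $i\ne i'$ in $I^{(j)}$; (b) there is an open connected set $V\supset X$ such that every $\phi^{(j)}_i$ extends to a $C^1$ conformal diffeomorphism of $V$ into $V$ (the derivative at each point is an invertible similarity, whose scaling factor is denoted $|D\phi(x)|$); (c) there is $K\ge1$ such that every composition $\phi=\phi^{(k)}_{\omega_k}\circ\dots\circ\phi^{(l)}_{\omega_l}$ with $k\le l$, $\omega_j\in I^{(j)}$, satisfies $|D\phi(x)|\le K|D\phi(y)|$ for all $x,y\in V$; (d) there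 is $\eta<1$ such that, for all sufficiently large $m$, all $j\ge1$ and all $\omega_k\in I^{(k)}$, the composition $\phi=\phi^{(j)}_{\omega_j}\circ\dots\circ\phi^{(j+m)}_{\omega_{j+m}}$ satisfies $|D\phi(x)|\le\eta^m$ for all $x\in X$. Write $\|D\phi\|=\sup_{x\in X}|D\phi(x)|$, $I^n=\prod_{j=1}^nI^{(j)}$ and $\phi_\omega=\phi^{(1)}_{\omega_1}\circ\dots\circ\phi^{(n)}_{\omega_n}$ for $\omega\in I^n$. The limit set is $J(\Phi)=\bigcap_{n\ge1}\bigcup_{\omega\in I^n}\phi_\omega(X)$. For $t\ge0$ put $Z_n(t)=\sum_{\omega\in I^n}\|D\phi_\omega\|^t$ and $\underline P(t)=\liminf_{n\to\infty}\frac1n\log Z_n(t)\in[-\infty,\infty]$. The Bowen dimension is $B(\Phi)=\sup\{t\ge0:\underline P(t)>0\}$ (with $\sup\emptyset=0$), and $\operatorname{HD}$ denotes Hausdorff dimension. **Proposition.** Let $\Phi$ be a non-autonomous conformal iterated function system on $X$ all of whose index sets $I^{(n)}$ are finite. Suppose that the limit $a=\lim_{n\to\infty}\frac1n\log\#I^{(n)}$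 exists, and that the limit $b=\lim_{n\to\infty}\frac1n\log\bigl(1/\|D\phi^{(n)}_j\|\bigr)$ exists uniformly in $j\in I^{(n)}$, i.e. for every $\varepsilon>0$ there is $N$ such that $\bigl|\frac1n\log(1/\|D\phi^{(n)}_j\|)-b\bigr|<\varepsilon$ for all $n\ge N$ and all $j\in I^{(n)}$; suppose that $a$ and $b$ are finite and positive. Then $B(\Phi)=a/b=\operatorname{HD}(J(\Phi))$. -/

import Mathlib

open Filter Topology
open scoped NNReal ENNReal

universe u

/-- The boundary of `X` is smooth: near each of its points it is the zero set of a smooth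
function with nonvanishing derivative, i.e. it is an embedded smooth hypersurface. -/
def HasSmoothBoundary {d : ℕ} (X : Set (EuclideanSpace ℝ (Fin d))) : Prop :=
  ∀ p ∈ frontier X, ∃ U : Set (EuclideanSpace ℝ (Fin d)),
    ∃ g : EuclideanSpace ℝ (Fin d) → ℝ,
      IsOpen U ∧ p ∈ U ∧ ContDiffOn ℝ (⊤ : ℕ∞) g U ∧ fderiv ℝ g p ≠ 0 ∧
        frontier X ∩ U = {x ∈ U | g x = 0}

/-- The (interior) cone condition: there are an opening angle (with cosine `κ`) and a length `l`
such that every boundary point of `X` is the vertex of an open cone with that angle and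
that length contained in the interior of `X`. -/
def HasConeCondition {d : ℕ} (X : Set (EuclideanSpace ℝ (Fin d))) : Prop :=
  ∃ κ l : ℝ, 0 ≤ κ ∧ κ < 1 ∧ 0 < l ∧
    ∀ x ∈ frontier X, ∃ v : EuclideanSpace ℝ (Fin d), ‖v‖ = 1 ∧
      ∀ y : EuclideanSpace ℝ (Fin d),
        0 < ‖y - x‖ → ‖y - x‖ < l → κ * ‖y - x‖ < inner ℝ (y - x) v → y ∈ interior X

/-- The standing assumptions on the phase space `X ⊆ ℝ^d`. -/
structure IsPhaseSpace {d : ℕ} (X : Set (EuclideanSpace ℝ (Fin d))) : Prop where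
  nonempty : X.Nonempty
  isCompact : IsCompact X
  closure_interior : closure (interior X) = X
  geometry : Convex ℝ X ∨ HasSmoothBoundary X ∨ HasConeCondition X

/-- Words `ω_m ω_{m+1} … ω_{m+n-1}` of length `n` that start at level `m`. Levels are numbered
from `0`, so `I j` is the alphabet usually written `I^{(j+1)}`. -/
abbrev Word (I : ℕ → Type u) (m n : ℕ) : Type u := (k : Fin n) → I (m + k)

/-- The composition `φ_{ω_m} ∘ φ_{ω_{m+1}} ∘ … ∘ φ_{ω_{m+n-1}}` along a word `ω` of length `n`
starting at level `m` (the identity for the empty word). -/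
def wordMap {d : ℕ} {I : ℕ → Type u}
    (φ : (j : ℕ) → I j → EuclideanSpace ℝ (Fin d) → EuclideanSpace ℝ (Fin d)) (m : ℕ) :
    (n : ℕ) → Word I m n → EuclideanSpace ℝ (Fin d) → EuclideanSpace ℝ (Fin d)
  | 0, _ => id
  | n + 1, ω => wordMap φ m n (fun k => ω k.castSucc) ∘ φ (m + n) (ω (Fin.last n))

/-- A non-autonomous conformal iterated function system on `X`. Each map is given together with
its extension to the common domain `V ⊇ X`; values of `map j i` outside `V` are irrelevant.
`I j`, `map j` are the alphabet and the maps of the `(j+1)`-st system `Φ^{(j+1)}`.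
On `V` the operator norm `‖fderiv ℝ φ x‖` is the scaling factor of the similarity `Dφ(x)`. -/
structure NCIFS {d : ℕ} (X : Set (EuclideanSpace ℝ (Fin d))) where
  /-- the alphabets -/
  I : ℕ → Type u
  nonempty : ∀ j, Nonempty (I j)
  countable : ∀ j, Countable (I j)
  /-- the maps, extended to `V` -/
  map : (j : ℕ) → I j → EuclideanSpace ℝ (Fin d) → EuclideanSpace ℝ (Fin d)
  mapsTo : ∀ j i, Set.MapsTo (map j i) X X
  /-- open set condition -/
  open_set_condition : ∀ j (a b : I j), a ≠ b →
    Disjoint (map j a '' interior X) (map j b '' interior X)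
  /-- the common domain of the extended maps -/
  V : Set (EuclideanSpace ℝ (Fin d))
  isOpen_V : IsOpen V
  isConnected_V : IsConnected V
  subset_V : X ⊆ V
  /-- each map is a `C^1` conformal diffeomorphism of `V` into `V` (injective, `C^1`, and with
  derivative an invertible similarity everywhere) -/
  mapsTo_V : ∀ j i, Set.MapsTo (map j i) V V
  injOn_V : ∀ j i, Set.InjOn (map j i) V
  contDiffOn_V : ∀ j i, ContDiffOn ℝ 1 (map j i) V
  conformalAt_V : ∀ j i, ∀ x ∈ V, ConformalAt (map j i) x
  bounded_distortion : ∃ K : ℝ, 1 ≤ K ∧ ∀ (m n : ℕ) (ω : Word I m n), ∀ x ∈ V, ∀ y ∈ V,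
    ‖fderiv ℝ (wordMap map m n ω) x‖ ≤ K * ‖fderiv ℝ (wordMap map m n ω) y‖
  uniform_contraction : ∃ η : ℝ, η < 1 ∧ ∃ N : ℕ, ∀ n, N ≤ n → ∀ (m : ℕ) (ω : Word I m (n + 1)),
    ∀ x ∈ X, ‖fderiv ℝ (wordMap map m (n + 1) ω) x‖ ≤ η ^ n

/-- `‖Dφ‖ = sup_{x ∈ X} |Dφ(x)|`. -/
noncomputable def derivNorm {d : ℕ} (X : Set (EuclideanSpace ℝ (Fin d)))
    (φ : EuclideanSpace ℝ (Fin d) → EuclideanSpace ℝ (Fin d)) : ℝ :=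
  sSup ((fun x => ‖fderiv ℝ φ x‖) '' X)

namespace NCIFS

variable {d : ℕ} {X : Set (EuclideanSpace ℝ (Fin d))}

/-- `X_n`, the union of `φ_ω(X)` over all initial words `ω` of length `n`. -/
def levelSet (Φ : NCIFS.{u} X) (n : ℕ) : Set (EuclideanSpace ℝ (Fin d)) :=
  ⋃ ω : Word Φ.I 0 n, wordMap Φ.map 0 n ω '' X

/-- The limit set `J(Φ) = ⋂_{n ≥ 1} X_n`. -/
def limitSet (Φ : NCIFS.{u} X) : Set (EuclideanSpace ℝ (Fin d)) :=
  ⋂ (n : ℕ) (_ : 1 ≤ n), Φ.levelSet n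

/-- `Z_n(t) = ∑_{ω} ‖Dφ_ω‖^t`, the sum over all initial words of length `n`. -/
noncomputable def Z (Φ : NCIFS.{u} X) (n : ℕ) (t : ℝ≥0) : ℝ≥0∞ :=
  ∑' ω : Word Φ.I 0 n, ENNReal.ofReal (derivNorm X (wordMap Φ.map 0 n ω) ^ (t : ℝ))

/-- The lower pressure `liminf (1/n) log Z_n(t) ∈ [-∞, ∞]`. -/
noncomputable def lowerPressure (Φ : NCIFS.{u} X) (t : ℝ≥0) : EReal :=
  liminf (fun n : ℕ => ENNReal.log (Φ.Z n t) / (n : EReal)) atTop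

/-- The Bowen dimension `B(Φ)`: the supremum of all `t ≥ 0` with positive lower pressure
(zero if there are none). -/
noncomputable def bowenDim (Φ : NCIFS.{u} X) : ℝ≥0∞ :=
  ⨆ (t : ℝ≥0) (_ : 0 < Φ.lowerPressure t), (t : ℝ≥0∞)

end NCIFS

/-! Alphabet sizes and contraction rates are exponential in the level, so words of length n live on
the scale exp(c n²). There are exp((a/2 + o(1)) n²) of them, and by the chain rule for conformal
maps all their derivatives have norm exp(-(b/2 + o(1)) n²), uniformly: distortion costs a factor K
per letter, and K^n = exp(o(n²)). Hence Z_n(t) = exp(((a - t b)/2 + o(1)) n²), so the lower pressure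
changes sign at t = a/b (`HasScales.bowenDim_eq`).

For t > a/b the covers by level-n pieces keep the t-dimensional Hausdorff measure finite
(`HasScales.dimH_limitSet_le`). For t < a/b the mass distribution principle applies to the uniform
Bernoulli measure on infinite words, pushed to the limit set. By disjointness and volume, a set of
diameter at most M n meets only exp(o(n²)) pieces of level n (`HasScales.exists_card_le`), so its
mass is at most exp(-(a/2 - o(1)) n²). As (n+1)²/n² tends to 1, this is eventually below M (n+1)^t,
which handles all diameters between consecutive scales (`HasScales.le_dimH_limitSet`). -/

/-! ### Norms and determinants of conformal linear maps -/

section Conformal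

variable {E F G : Type*} [NormedAddCommGroup E] [NormedSpace ℝ E] [NormedAddCommGroup F]
  [NormedSpace ℝ F] [NormedAddCommGroup G] [NormedSpace ℝ G]

theorem IsConformalMap.norm_apply_eq [Nontrivial E] {f : E →L[ℝ] F} (hf : IsConformalMap f)
    (v : E) : ‖f v‖ = ‖f‖ * ‖v‖ := by
  obtain ⟨c, hc, li, rfl⟩ := hf
  rw [norm_smul, li.norm_toContinuousLinearMap]
  simp [norm_smul]

theorem IsConformalMap.norm_pos [Nontrivial E] {f : E →L[ℝ] F} (hf : IsConformalMap f) :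
    0 < ‖f‖ := by
  obtain ⟨c, hc, li, rfl⟩ := hf
  rw [norm_smul, li.norm_toContinuousLinearMap]
  simpa using hc

/-- Equality, not mere submultiplicativity, is what allows lower bounds on the derivatives of
compositions. -/
theorem IsConformalMap.norm_comp [Nontrivial E] [Nontrivial F] {g : F →L[ℝ] G} {f : E →L[ℝ] F}
    (hg : IsConformalMap g) (hf : IsConformalMap f) : ‖g.comp f‖ = ‖g‖ * ‖f‖ := by
  obtain ⟨v, hv⟩ := exists_ne (0 : E)
  have h := (hg.comp hf).norm_apply_eq v
  rw [ContinuousLinearMap.comp_apply, hg.norm_apply_eq, hf.norm_apply_eq, ← mul_assoc] at h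
  exact (mul_right_cancel₀ (norm_ne_zero_iff.2 hv) h).symm

theorem ConformalAt.norm_fderiv_comp [Nontrivial E] [Nontrivial F] {g : F → G} {f : E → F} {x : E}
    (hg : ConformalAt g (f x)) (hf : ConformalAt f x) :
    ‖fderiv ℝ (g ∘ f) x‖ = ‖fderiv ℝ g (f x)‖ * ‖fderiv ℝ f x‖ := by
  rw [fderiv_comp x hg.differentiableAt hf.differentiableAt]
  exact (conformalAt_iff_isConformalMap_fderiv.1 hg).norm_comp
    (conformalAt_iff_isConformalMap_fderiv.1 hf)

theorem ConformalAt.norm_fderiv_pos [Nontrivial E] {f : E → F} {x : E} (hf : ConformalAt f x) :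
    0 < ‖fderiv ℝ f x‖ :=
  (conformalAt_iff_isConformalMap_fderiv.1 hf).norm_pos

theorem IsConformalMap.range_eq_top [FiniteDimensional ℝ E] {f : E →L[ℝ] E}
    (hf : IsConformalMap f) : f.toLinearMap.range = ⊤ :=
  LinearMap.range_eq_top.2 (LinearMap.surjective_of_injective (f := f.toLinearMap) hf.injective)

end Conformal

theorem IsConformalMap.abs_det {E : Type*} [NormedAddCommGroup E] [InnerProductSpace ℝ E]
    [FiniteDimensional ℝ E] [Nontrivial E] {f : E →L[ℝ] E} (hf : IsConformalMap f) :
    |f.det| = ‖f‖ ^ Module.finrank ℝ E := by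
  obtain ⟨c, hc, li, rfl⟩ := hf
  rw [norm_smul, li.norm_toContinuousLinearMap, mul_one, ContinuousLinearMap.det,
    ← Real.norm_eq_abs, ← LinearMap.normDet_eq_norm_det]
  have : ((c • li.toContinuousLinearMap : E →L[ℝ] E) : E →ₗ[ℝ] E) = c • li.toLinearMap := rfl
  rw [this, LinearMap.normDet_smul, li.normDet_eq_one, mul_one]

/-! ### Two analytic tools: oscillation bounds and quadratic growth of sums -/

/-- A uniform bound on the oscillation over a compact subset of a connected open set of all
functions whose derivative is bounded there. -/
theorem IsConnected.exists_forall_dist_le_mul {E F : Type*} [NormedAddCommGroup E]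
    [NormedSpace ℝ E] [NormedAddCommGroup F] [NormedSpace ℝ F] {V X : Set E} (hV : IsOpen V)
    (hVc : IsConnected V) (hX : IsCompact X) (hXV : X ⊆ V) :
    ∃ C : ℝ, 0 < C ∧ ∀ (f : E → F) (M : ℝ), 0 ≤ M → (∀ x ∈ V, DifferentiableAt ℝ f x) →
      (∀ x ∈ V, ‖fderiv ℝ f x‖ ≤ M) → ∀ x ∈ X, ∀ y ∈ X, dist (f x) (f y) ≤ C * M := by
  obtain ⟨x₀, hx₀⟩ := hVc.nonempty
  -- The bound relative to the base point spreads across balls by the mean value inequality. The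
  -- points having it form a relatively clopen subset of `V`, hence all of `V`; compactness then
  -- makes the constant uniform on `X`.
  let P : Set E → Prop := fun s => ∃ C : ℝ, 0 ≤ C ∧ ∀ (f : E → F) (M : ℝ), 0 ≤ M →
    (∀ x ∈ V, DifferentiableAt ℝ f x) → (∀ x ∈ V, ‖fderiv ℝ f x‖ ≤ M) →
    ∀ x ∈ s, dist (f x) (f x₀) ≤ C * M
  have hball : ∀ x r, Metric.ball x r ⊆ V → ∀ y ∈ Metric.ball x r, P {y} →
      P (Metric.ball x r) := by
    rintro x r hb y hy ⟨C, hC, h⟩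
    have hr : 0 < r := Metric.pos_of_mem_ball hy
    refine ⟨2 * r + C, by positivity, fun f M hM hd hf z hz => ?_⟩
    have h1 : dist (f z) (f y) ≤ M * dist z y := by
      rw [dist_eq_norm, dist_eq_norm]
      exact (convex_ball x r).norm_image_sub_le_of_norm_fderiv_le (fun w hw => hd w (hb hw))
        (fun w hw => hf w (hb hw)) hy hz
    have h2 : dist z y ≤ 2 * r := by
      have := dist_triangle_right z y x
      rw [Metric.mem_ball] at hy hz
      linarith
    have h3 := h f M hM hd hf y rfl
    have h4 := dist_triangle (f z) (f y) (f x₀)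
    nlinarith [mul_le_mul_of_nonneg_left h2 hM]
  have hmono : ∀ {s t : Set E}, s ⊆ t → P t → P s := by
    rintro s t hst ⟨C, hC, h⟩
    exact ⟨C, hC, fun f M hM hd hf x hx => h f M hM hd hf x (hst hx)⟩
  have hVsub : V ⊆ {x | P {x}} := by
    have hopen : IsOpen {x | x ∈ V ∧ P {x}} := by
      refine isOpen_iff_mem_nhds.2 fun x hx => ?_
      obtain ⟨r, hr, hb⟩ := Metric.isOpen_iff.1 hV x hx.1
      filter_upwards [Metric.ball_mem_nhds x hr] with y hy
      exact ⟨hb hy, hmono (Set.singleton_subset_iff.2 hy)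
        (hball x r hb x (Metric.mem_ball_self hr) hx.2)⟩
    have := hVc.isPreconnected.subset_of_closure_inter_subset hopen
      ⟨x₀, hx₀, hx₀, 0, le_rfl, by rintro f M - - - x rfl; simp⟩ (by
        rintro x ⟨hxc, hxV⟩
        obtain ⟨r, hr, hb⟩ := Metric.isOpen_iff.1 hV x hxV
        obtain ⟨y, hy, hyb⟩ := mem_closure_iff_nhds.1 hxc _ (Metric.ball_mem_nhds x hr)
        exact ⟨hxV, hmono (Set.singleton_subset_iff.2 (Metric.mem_ball_self hr))
          (hball x r hb y hy hyb.2)⟩)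
    exact fun x hx => (this hx).2
  have hXP : P X := by
    refine hX.induction_on (p := P) ⟨0, le_rfl, by simp⟩ (fun s t h => hmono h) ?_ ?_
    · rintro s t ⟨C, hC, h⟩ ⟨C', hC', h'⟩
      refine ⟨max C C', le_max_of_le_left hC, fun f M hM hd hf x hx => ?_⟩
      rcases hx with hx | hx
      · exact (h f M hM hd hf x hx).trans (mul_le_mul_of_nonneg_right (le_max_left _ _) hM)
      · exact (h' f M hM hd hf x hx).trans (mul_le_mul_of_nonneg_right (le_max_right _ _) hM)
    · intro x hx
      obtain ⟨r, hr, hb⟩ := Metric.isOpen_iff.1 hV x (hXV hx)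
      exact ⟨_, mem_nhdsWithin_of_mem_nhds (Metric.ball_mem_nhds x hr),
        hball x r hb x (Metric.mem_ball_self hr) (hVsub (hXV hx))⟩
  obtain ⟨C, hC, h⟩ := hXP
  refine ⟨2 * C + 1, by positivity, fun f M hM hd hf x hx y hy => ?_⟩
  have h1 := h f M hM hd hf x hx
  have h2 := h f M hM hd hf y hy
  have h3 := dist_triangle_right (f x) (f y) (f x₀)
  linarith

/-- If `u n / (n + 1)` converges to `L`, the partial sums of `u` grow like `L n² / 2`. -/
theorem tendsto_sum_range_div_sq {u : ℕ → ℝ} {L : ℝ}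
    (h : Tendsto (fun n : ℕ => 1 / ((n : ℝ) + 1) * u n) atTop (𝓝 L)) :
    Tendsto (fun n : ℕ => (∑ k ∈ Finset.range n, u k) / (n : ℝ) ^ 2) atTop (𝓝 (L / 2)) := by
  have hsum : ∀ n : ℕ, ∑ k ∈ Finset.range n, ((k : ℝ) + 1) = (n : ℝ) * (n + 1) / 2 := by
    intro n
    induction n with
    | zero => simp
    | succ n ih => rw [Finset.sum_range_succ, ih]; push_cast; ring
  have hinv : Tendsto (fun n : ℕ => (n : ℝ)⁻¹) atTop (𝓝 0) := tendsto_inv_atTop_nhds_zero_nat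
  have ho : (fun n : ℕ => u n - L * ((n : ℝ) + 1)) =o[atTop] fun n : ℕ => (n : ℝ) + 1 := by
    rw [Asymptotics.isLittleO_iff_tendsto (fun n hn => absurd hn (by positivity))]
    have := h.sub_const L
    rw [sub_self] at this
    refine this.congr fun n => ?_
    field_simp
  have ho2 := ho.sum_range (fun n => by positivity) (by
    simp_rw [hsum]
    refine tendsto_atTop_mono (fun n : ℕ => ?_) (tendsto_natCast_atTop_atTop.atTop_div_const two_pos)
    nlinarith [sq_nonneg (n : ℝ)])
  have h3 : Tendsto (fun n : ℕ => ((n : ℝ) * (n + 1) / 2) / (n : ℝ) ^ 2) atTop (𝓝 (1 / 2)) := by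
    have : Tendsto (fun n : ℕ => (1 + (n : ℝ)⁻¹) / 2) atTop (𝓝 ((1 + 0) / 2)) :=
      (tendsto_const_nhds.add hinv).div_const 2
    rw [add_zero] at this
    refine this.congr' ?_
    filter_upwards [eventually_gt_atTop 0] with n hn
    have : (n : ℝ) ≠ 0 := by positivity
    field_simp
  have h4 := ho2.tendsto_div_nhds_zero
  have h5 := (h4.mul h3).add (h3.const_mul L)
  rw [zero_mul, zero_add, mul_one_div] at h5
  refine h5.congr' ?_
  filter_upwards [eventually_gt_atTop 0] with n hn
  have : (n : ℝ) ≠ 0 := by positivity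
  simp_rw [Finset.sum_sub_distrib, ← Finset.mul_sum, hsum]
  field_simp
  ring

/-! ### Compositions along words: disjointness, derivatives, scales -/

namespace NCIFS

variable {d : ℕ} {X : Set (EuclideanSpace ℝ (Fin d))}

theorem wordMap_injOn (Φ : NCIFS.{u} X) (m n : ℕ) (ω : Word Φ.I m n) :
    Set.InjOn (wordMap Φ.map m n ω) Φ.V := by
  induction n with
  | zero => exact Set.injOn_id _
  | succ n ih => exact (ih _).comp (Φ.injOn_V _ _) (Φ.mapsTo_V _ _)

theorem wordMap_conformalAt (Φ : NCIFS.{u} X) (m n : ℕ) (ω : Word Φ.I m n)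
    {x : EuclideanSpace ℝ (Fin d)} (hx : x ∈ Φ.V) : ConformalAt (wordMap Φ.map m n ω) x := by
  induction n generalizing x with
  | zero => exact conformalAt_id x
  | succ n ih => exact (ih _ (Φ.mapsTo_V _ _ hx)).comp x (Φ.conformalAt_V _ _ x hx)

theorem wordMap_continuousOn (Φ : NCIFS.{u} X) (m n : ℕ) (ω : Word Φ.I m n) :
    ContinuousOn (wordMap Φ.map m n ω) Φ.V := fun _ hx =>
  (Φ.wordMap_conformalAt m n ω hx).differentiableAt.continuousAt.continuousWithinAt

theorem map_nhds_eq (Φ : NCIFS.{u} X) (j : ℕ) (i : Φ.I j) {x : EuclideanSpace ℝ (Fin d)}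
    (hx : x ∈ Φ.V) : Filter.map (Φ.map j i) (𝓝 x) = 𝓝 (Φ.map j i x) := by
  have h := ((Φ.contDiffOn_V j i).contDiffAt (Φ.isOpen_V.mem_nhds hx)).hasStrictFDerivAt one_ne_zero
  exact h.map_nhds_eq_of_surj
    (conformalAt_iff_isConformalMap_fderiv.1 (Φ.conformalAt_V j i x hx)).range_eq_top

/-- The maps are open on `V` by the inverse function theorem. This lets the open set condition pass
from letters to words. -/
theorem map_mapsTo_interior (Φ : NCIFS.{u} X) (j : ℕ) (i : Φ.I j) :
    Set.MapsTo (Φ.map j i) (interior X) (interior X) := by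
  intro x hx
  rw [mem_interior_iff_mem_nhds, ← Φ.map_nhds_eq j i (Φ.subset_V (interior_subset hx)),
    Filter.mem_map]
  exact mem_of_superset (mem_interior_iff_mem_nhds.1 hx) (Φ.mapsTo j i)

/-- If the prefixes differ, the images lie in disjoint images of the prefixes; if they agree, the
last letters differ and the common prefix map is injective. -/
theorem wordMap_disjoint (Φ : NCIFS.{u} X) (m n : ℕ) {ω ω' : Word Φ.I m n} (h : ω ≠ ω') :
    Disjoint (wordMap Φ.map m n ω '' interior X) (wordMap Φ.map m n ω' '' interior X) := by
  induction n with
  | zero => exact absurd (Subsingleton.elim _ _) h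
  | succ n ih =>
    simp only [wordMap, Set.image_comp]
    by_cases hp : (fun k : Fin n => ω k.castSucc) = fun k : Fin n => ω' k.castSucc
    · have hl : ω (Fin.last n) ≠ ω' (Fin.last n) := by
        intro hl
        apply h
        funext k
        refine Fin.lastCases hl (fun k => ?_) k
        exact congrFun hp k
      rw [hp]
      have hsub : ∀ i : Φ.I (m + n), Φ.map (m + n) i '' interior X ⊆ Φ.V := fun i =>
        (Φ.map_mapsTo_interior _ i).image_subset.trans (interior_subset.trans Φ.subset_V)
      have hdisj := (Φ.open_set_condition (m + n) (ω (Fin.last n)) (ω' (Fin.last n)) hl).inter_eq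
      rw [Set.disjoint_iff_inter_eq_empty,
        ← (Φ.wordMap_injOn m n _).image_inter (hsub _) (hsub _)]
      exact (congrArg _ hdisj).trans (Set.image_empty _)
    · exact (ih hp).mono (Set.image_mono (Φ.map_mapsTo_interior _ _).image_subset)
        (Set.image_mono (Φ.map_mapsTo_interior _ _).image_subset)

/-- A distortion constant of the system. -/
theorem exists_norm_fderiv_map_bounds (Φ : NCIFS.{u} X) (hX : X.Nonempty) :
    ∃ K : ℝ, 1 ≤ K ∧ ∀ (j : ℕ) (i : Φ.I j), ∀ x ∈ Φ.V,
      ‖fderiv ℝ (Φ.map j i) x‖ ≤ K * derivNorm X (Φ.map j i) ∧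
      derivNorm X (Φ.map j i) ≤ K * ‖fderiv ℝ (Φ.map j i) x‖ := by
  obtain ⟨K, hK, h⟩ := Φ.bounded_distortion
  obtain ⟨y, hy⟩ := hX
  refine ⟨K, hK, fun j i x hx => ?_⟩
  have h1 : ∀ x ∈ Φ.V, ∀ y ∈ Φ.V,
      ‖fderiv ℝ (Φ.map j i) x‖ ≤ K * ‖fderiv ℝ (Φ.map j i) y‖ :=
    -- A single map is the composition along a one-letter word, up to definitional unfolding.
    h j 1 (Fin.cons i finZeroElim)
  have h2 : ∀ r ∈ (fun x => ‖fderiv ℝ (Φ.map j i) x‖) '' X, r ≤ K * ‖fderiv ℝ (Φ.map j i) x‖ := by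
    rintro _ ⟨z, hz, rfl⟩
    exact h1 z (Φ.subset_V hz) x hx
  refine ⟨(h1 x hx y (Φ.subset_V hy)).trans ?_, csSup_le ⟨_, y, hy, rfl⟩ h2⟩
  exact mul_le_mul_of_nonneg_left (le_csSup ⟨_, h2⟩ ⟨y, hy, rfl⟩) (by linarith)

theorem derivNorm_map_pos (Φ : NCIFS.{u} X) (hd : 1 ≤ d) (hX : X.Nonempty) (j : ℕ) (i : Φ.I j) :
    0 < derivNorm X (Φ.map j i) := by
  have : Nonempty (Fin d) := ⟨⟨0, hd⟩⟩
  obtain ⟨K, hK, h⟩ := Φ.exists_norm_fderiv_map_bounds hX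
  obtain ⟨y, hy⟩ := hX
  have h1 := (h j i y (Φ.subset_V hy)).1
  have h2 := (Φ.conformalAt_V j i y (Φ.subset_V hy)).norm_fderiv_pos
  exact pos_of_mul_pos_right (h2.trans_le h1) (by linarith)

theorem norm_fderiv_wordMap_mem_Icc (Φ : NCIFS.{u} X) (hd : 1 ≤ d) {l u : ℕ → ℝ}
    (hl : ∀ j, 0 ≤ l j)
    (h : ∀ j i, ∀ x ∈ Φ.V, ‖fderiv ℝ (Φ.map j i) x‖ ∈ Set.Icc (l j) (u j)) (m n : ℕ)
    (ω : Word Φ.I m n) {x : EuclideanSpace ℝ (Fin d)} (hx : x ∈ Φ.V) :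
    ‖fderiv ℝ (wordMap Φ.map m n ω) x‖ ∈
      Set.Icc (∏ k ∈ Finset.range n, l (m + k)) (∏ k ∈ Finset.range n, u (m + k)) := by
  have : Nonempty (Fin d) := ⟨⟨0, hd⟩⟩
  induction n generalizing x with
  | zero =>
    have : fderiv ℝ (wordMap Φ.map m 0 ω) x = ContinuousLinearMap.id ℝ _ := fderiv_id
    simp [this]
  | succ n ih =>
    have hx' := Φ.mapsTo_V (m + n) (ω (Fin.last n)) hx
    have h1 := ih (fun k => ω k.castSucc) hx'
    have h2 := h (m + n) (ω (Fin.last n)) x hx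
    have h3 := (Φ.wordMap_conformalAt m n (fun k => ω k.castSucc) hx').norm_fderiv_comp
      (Φ.conformalAt_V (m + n) (ω (Fin.last n)) x hx)
    rw [Finset.prod_range_succ, Finset.prod_range_succ, wordMap, h3]
    exact ⟨mul_le_mul h1.1 h2.1 (hl _) (norm_nonneg _),
      mul_le_mul h1.2 h2.2 (norm_nonneg _) ((norm_nonneg _).trans h1.2)⟩

/-- All maps of level `n` contract at rates between `m n` and `M n`, and both rates
are `exp (-(b / 2 + o(1)) n²)`. -/
structure HasScales (Φ : NCIFS.{u} X) (b : ℝ) (m M : ℕ → ℝ) : Prop where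
  pos : ∀ n, 0 < m n
  mem_Icc : ∀ n (ω : Word Φ.I 0 n), ∀ x ∈ Φ.V,
    ‖fderiv ℝ (wordMap Φ.map 0 n ω) x‖ ∈ Set.Icc (m n) (M n)
  tendsto_lower : Tendsto (fun n : ℕ => Real.log (m n) / (n : ℝ) ^ 2) atTop (𝓝 (-(b / 2)))
  tendsto_upper : Tendsto (fun n : ℕ => Real.log (M n) / (n : ℝ) ^ 2) atTop (𝓝 (-(b / 2)))

/-- The scales are products of the extreme letter norms of each level, corrected by K or its
inverse. The correction contributes ± n log K to the logarithm, which vanishes after division by n².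
-/
theorem exists_hasScales (Φ : NCIFS.{u} X) (hd : 1 ≤ d) (hX : X.Nonempty)
    (hfin : ∀ n, Finite (Φ.I n)) {b : ℝ}
    (hlim : ∀ ε : ℝ, 0 < ε → ∃ N : ℕ, ∀ n, N ≤ n → ∀ j : Φ.I n,
      |1 / ((n : ℝ) + 1) * Real.log (1 / derivNorm X (Φ.map n j)) - b| < ε) :
    ∃ m M : ℕ → ℝ, Φ.HasScales b m M := by
  obtain ⟨K, hK, hKb⟩ := Φ.exists_norm_fderiv_map_bounds hX
  have hpos := Φ.derivNorm_map_pos hd hX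
  have := Φ.nonempty
  choose p hp using fun n => Finite.exists_max fun i : Φ.I n => derivNorm X (Φ.map n i)
  choose q hq using fun n => Finite.exists_min fun i : Φ.I n => derivNorm X (Φ.map n i)
  have key : ∀ (c : ℝ) (r : ∀ n, Φ.I n), 0 < c →
      Tendsto (fun n : ℕ => Real.log (∏ k ∈ Finset.range n, c * derivNorm X (Φ.map (0 + k) (r (0 + k))))
        / (n : ℝ) ^ 2) atTop (𝓝 (-(b / 2))) := by
    intro c r hc
    have h1 : Tendsto (fun n : ℕ => 1 / ((n : ℝ) + 1) * Real.log (c * derivNorm X (Φ.map n (r n))))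
        atTop (𝓝 (-b)) := by
      have h2 : Tendsto (fun n : ℕ => 1 / ((n : ℝ) + 1) * Real.log (1 / derivNorm X (Φ.map n (r n))))
          atTop (𝓝 b) := by
        refine Metric.tendsto_atTop.2 fun ε hε => ?_
        obtain ⟨N, hN⟩ := hlim ε hε
        exact ⟨N, fun n hn => hN n hn (r n)⟩
      have h3 := (tendsto_one_div_add_atTop_nhds_zero_nat (𝕜 := ℝ)).mul_const (Real.log c)
      have h4 := h3.sub h2
      rw [zero_mul, zero_sub] at h4
      refine h4.congr fun n => ?_
      rw [Real.log_mul hc.ne' (hpos _ _).ne', one_div (derivNorm _ _), Real.log_inv]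
      ring
    have h5 := tendsto_sum_range_div_sq h1
    rw [neg_div] at h5
    refine h5.congr fun n => ?_
    rw [Real.log_prod fun k _ => (mul_pos hc (hpos _ _)).ne']
    -- The letter type depends on the level, so the passage from `0 + k` to `k` goes through a
    -- function of the level alone.
    let g : ℕ → ℝ := fun j => Real.log (c * derivNorm X (Φ.map j (r j)))
    exact congrArg (· / (n : ℝ) ^ 2)
      (Finset.sum_congr rfl fun k _ => (congrArg g (Nat.zero_add k)).symm)
  have hK0 : 0 < K := by linarith
  refine ⟨fun n => ∏ k ∈ Finset.range n, K⁻¹ * derivNorm X (Φ.map (0 + k) (q (0 + k))),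
    fun n => ∏ k ∈ Finset.range n, K * derivNorm X (Φ.map (0 + k) (p (0 + k))),
    fun n => Finset.prod_pos fun k _ => mul_pos (inv_pos.2 hK0) (hpos _ _),
    fun n ω x hx => Φ.norm_fderiv_wordMap_mem_Icc hd
      (l := fun j => K⁻¹ * derivNorm X (Φ.map j (q j))) (u := fun j => K * derivNorm X (Φ.map j (p j)))
      (fun j => (mul_pos (inv_pos.2 hK0) (hpos _ _)).le)
      (fun j i x hx => ⟨?_, ?_⟩) 0 n ω hx, key _ q (inv_pos.2 hK0), key _ p hK0⟩
  · rw [inv_mul_le_iff₀ hK0]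
    exact (hq j i).trans (hKb j i x hx).2
  · exact (hKb j i x hx).1.trans (mul_le_mul_of_nonneg_left (hp j i) hK0.le)

theorem tendsto_log_card_word (Φ : NCIFS.{u} X) (hfin : ∀ n, Finite (Φ.I n)) {a : ℝ}
    (hlim : Tendsto (fun n : ℕ => 1 / ((n : ℝ) + 1) * Real.log (Nat.card (Φ.I n)))
      atTop (𝓝 a)) :
    Tendsto (fun n : ℕ => Real.log (Nat.card (Word Φ.I 0 n)) / (n : ℝ) ^ 2) atTop (𝓝 (a / 2)) := by
  refine (tendsto_sum_range_div_sq hlim).congr fun n => ?_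
  have := Φ.nonempty
  rw [Nat.card_pi, Fin.prod_univ_eq_prod_range (fun k => Nat.card (Φ.I (0 + k))), Nat.cast_prod,
    Real.log_prod fun k _ => Nat.cast_ne_zero.2 Nat.card_pos.ne']
  simp only [Nat.zero_add]

variable {Φ : NCIFS.{u} X} {b : ℝ} {m M : ℕ → ℝ}

theorem HasScales.le (h : Φ.HasScales b m M) (n : ℕ) : m n ≤ M n := by
  have := Φ.nonempty
  obtain ⟨x, hx⟩ := Φ.isConnected_V.nonempty
  have := h.mem_Icc n (fun _ => Classical.arbitrary _) x hx
  exact this.1.trans this.2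

theorem HasScales.upper_pos (h : Φ.HasScales b m M) (n : ℕ) : 0 < M n :=
  (h.pos n).trans_le (h.le n)

theorem HasScales.derivNorm_mem_Icc (h : Φ.HasScales b m M) (hX : X.Nonempty) (n : ℕ)
    (ω : Word Φ.I 0 n) : derivNorm X (wordMap Φ.map 0 n ω) ∈ Set.Icc (m n) (M n) := by
  obtain ⟨y, hy⟩ := hX
  have hb : ∀ r ∈ (fun x => ‖fderiv ℝ (wordMap Φ.map 0 n ω) x‖) '' X, r ≤ M n := by
    rintro _ ⟨z, hz, rfl⟩
    exact (h.mem_Icc n ω z (Φ.subset_V hz)).2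
  exact ⟨(h.mem_Icc n ω y (Φ.subset_V hy)).1.trans (le_csSup ⟨_, hb⟩ ⟨y, hy, rfl⟩),
    csSup_le ⟨_, y, hy, rfl⟩ hb⟩

theorem HasScales.tendsto_upper_zero (h : Φ.HasScales b m M) (hb : 0 < b) :
    Tendsto M atTop (𝓝 0) := by
  have h1 : Tendsto (fun n : ℕ => Real.log (M n)) atTop atBot := by
    have h2 : Tendsto (fun n : ℕ => (n : ℝ) ^ 2) atTop atTop :=
      (tendsto_pow_atTop two_ne_zero).comp tendsto_natCast_atTop_atTop
    refine (h.tendsto_upper.neg_mul_atTop (by linarith) h2).congr' ?_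
    filter_upwards [eventually_gt_atTop 0] with n hn
    field_simp
  exact (Real.tendsto_exp_atBot.comp h1).congr fun n => Real.exp_log (h.upper_pos n)

theorem HasScales.exists_dist_le (h : Φ.HasScales b m M) (hX : IsCompact X) :
    ∃ C : ℝ, 0 < C ∧ ∀ n (ω : Word Φ.I 0 n), ∀ x ∈ X, ∀ y ∈ X,
      dist (wordMap Φ.map 0 n ω x) (wordMap Φ.map 0 n ω y) ≤ C * M n := by
  obtain ⟨C, hC, hdist⟩ := Φ.isConnected_V.exists_forall_dist_le_mul
    (F := EuclideanSpace ℝ (Fin d)) Φ.isOpen_V hX Φ.subset_V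
  exact ⟨C, hC, fun n ω => hdist _ _ (h.upper_pos n).le
    (fun x hx => (Φ.wordMap_conformalAt 0 n ω hx).differentiableAt)
    fun x hx => (h.mem_Icc n ω x hx).2⟩

open MeasureTheory in
theorem HasScales.le_volume_image (h : Φ.HasScales b m M) (hd : 1 ≤ d) (n : ℕ)
    (ω : Word Φ.I 0 n) : ENNReal.ofReal (m n ^ d) * volume (interior X) ≤
      volume (wordMap Φ.map 0 n ω '' interior X) := by
  have : Nonempty (Fin d) := ⟨⟨0, hd⟩⟩
  have hsub : interior X ⊆ Φ.V := interior_subset.trans Φ.subset_V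
  rw [← lintegral_abs_det_fderiv_eq_addHaar_image volume isOpen_interior.measurableSet
    (fun x hx => (Φ.wordMap_conformalAt 0 n ω (hsub hx)).differentiableAt.hasFDerivAt.hasFDerivWithinAt)
    ((Φ.wordMap_injOn 0 n ω).mono hsub), ← setLIntegral_const]
  refine setLIntegral_mono' isOpen_interior.measurableSet fun x hx => ENNReal.ofReal_le_ofReal ?_
  rw [(conformalAt_iff_isConformalMap_fderiv.1 (Φ.wordMap_conformalAt 0 n ω (hsub hx))).abs_det,
    finrank_euclideanSpace_fin]
  exact pow_le_pow_left₀ (h.pos n).le (h.mem_Icc n ω x (hsub hx)).1 d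

open MeasureTheory in
/-- A set of diameter at most `M n` meets few pieces of level `n`. -/
theorem HasScales.exists_card_le (h : Φ.HasScales b m M) (hd : 1 ≤ d) (hX : IsPhaseSpace X)
    (hfin : ∀ n, Finite (Φ.I n)) :
    ∃ Q : ℝ, 0 < Q ∧ ∀ n (s : Set (EuclideanSpace ℝ (Fin d))),
      Metric.ediam s ≤ ENNReal.ofReal (M n) →
      (Set.ncard {ω : Word Φ.I 0 n | (wordMap Φ.map 0 n ω '' X ∩ s).Nonempty} : ℝ) ≤
        Q * (M n / m n) ^ d := by
  obtain ⟨C, hC, hdist⟩ := h.exists_dist_le hX.isCompact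
  have hint : (interior X).Nonempty := by
    rw [← closure_nonempty_iff, hX.closure_interior]
    exact hX.nonempty
  set v := (volume (interior X)).toReal with hv
  have hvfin : volume (interior X) ≠ ⊤ :=
    ((measure_mono interior_subset).trans_lt hX.isCompact.measure_lt_top).ne
  have hv0 : 0 < v := ENNReal.toReal_pos (isOpen_interior.measure_pos volume hint).ne' hvfin
  set w := (volume (Metric.ball (0 : EuclideanSpace ℝ (Fin d)) 1)).toReal with hw
  have hwfin : volume (Metric.ball (0 : EuclideanSpace ℝ (Fin d)) 1) ≠ ⊤ := measure_ball_lt_top.ne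
  have hw0 : 0 < w := ENNReal.toReal_pos (Metric.measure_ball_pos volume _ one_pos).ne' hwfin
  -- Pieces meeting `s` have diameter at most C M n, so they lie in a ball of radius (C + 1) M n
  -- about any point of `s`. Their interiors' images are disjoint with volume at least (m n)^d v
  -- each; compare with the ball's volume.
  refine ⟨(C + 1) ^ d * w / v, by positivity, fun n s hs => ?_⟩
  have hM := h.upper_pos n
  have hm := h.pos n
  set A := {ω : Word Φ.I 0 n | (wordMap Φ.map 0 n ω '' X ∩ s).Nonempty} with hA
  rcases s.eq_empty_or_nonempty with rfl | ⟨y, hy⟩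
  · have : A = ∅ := by simp [hA]
    rw [this, Set.ncard_empty, Nat.cast_zero]
    positivity
  have hAfin : A.Finite := Set.toFinite A
  have hsub : ∀ ω ∈ A, wordMap Φ.map 0 n ω '' interior X ⊆ Metric.closedBall y ((C + 1) * M n) := by
    rintro ω ⟨_, ⟨x, hx, rfl⟩, hxs⟩ _ ⟨z, hz, rfl⟩
    have h1 := hdist n ω z (interior_subset hz) x hx
    have h2 : dist (wordMap Φ.map 0 n ω x) y ≤ M n :=
      (edist_le_ofReal hM.le).1 ((Metric.edist_le_ediam_of_mem hxs hy).trans hs)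
    have := dist_triangle (wordMap Φ.map 0 n ω z) (wordMap Φ.map 0 n ω x) y
    rw [Metric.mem_closedBall]
    linarith
  have hmeas : ∀ ω : Word Φ.I 0 n, MeasurableSet (wordMap Φ.map 0 n ω '' interior X) := fun ω =>
    isOpen_interior.measurableSet.image_of_continuousOn_injOn
      ((Φ.wordMap_continuousOn 0 n ω).mono (interior_subset.trans Φ.subset_V))
      ((Φ.wordMap_injOn 0 n ω).mono (interior_subset.trans Φ.subset_V))
  have hvol : (hAfin.toFinset.card : ℝ≥0∞) * (ENNReal.ofReal (m n ^ d) * volume (interior X)) ≤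
      ENNReal.ofReal (((C + 1) * M n) ^ d) * volume (Metric.ball (0 : EuclideanSpace ℝ (Fin d)) 1) := by
    calc _ = ∑ ω ∈ hAfin.toFinset, ENNReal.ofReal (m n ^ d) * volume (interior X) := by
          rw [Finset.sum_const, nsmul_eq_mul]
      _ ≤ ∑ ω ∈ hAfin.toFinset, volume (wordMap Φ.map 0 n ω '' interior X) :=
          Finset.sum_le_sum fun ω _ => h.le_volume_image hd n ω
      _ = volume (⋃ ω ∈ hAfin.toFinset, wordMap Φ.map 0 n ω '' interior X) :=
          (measure_biUnion_finset (fun ω _ ω' _ hne => Φ.wordMap_disjoint 0 n hne)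
            fun ω _ => hmeas ω).symm
      _ ≤ volume (Metric.closedBall y ((C + 1) * M n)) :=
          measure_mono (Set.iUnion₂_subset fun ω hω => hsub ω (hAfin.mem_toFinset.1 hω))
      _ = _ := by
          rw [Measure.addHaar_closedBall volume y (by positivity), finrank_euclideanSpace_fin]
  have hreal := ENNReal.toReal_mono (by finiteness) hvol
  simp only [ENNReal.toReal_mul, ENNReal.toReal_natCast] at hreal
  rw [ENNReal.toReal_ofReal (by positivity), ENNReal.toReal_ofReal (by positivity), ← hv, ← hw,
    ← Set.ncard_eq_toFinset_card A hAfin, mul_pow] at hreal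
  rw [div_pow, div_mul_div_comm, le_div_iff₀ (by positivity)]
  linarith

end NCIFS

/-! ### Pressure and the Bowen dimension -/

namespace NCIFS

variable {d : ℕ} {X : Set (EuclideanSpace ℝ (Fin d))} {Φ : NCIFS.{u} X} {b : ℝ} {m M : ℕ → ℝ}

theorem card_word_pos (Φ : NCIFS.{u} X) (hfin : ∀ n, Finite (Φ.I n)) (n : ℕ) :
    (0 : ℝ) < Nat.card (Word Φ.I 0 n) := by
  have := Φ.nonempty
  exact Nat.cast_pos.2 Nat.card_pos

theorem HasScales.eventually_card_mul_le_one (h : Φ.HasScales b m M)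
    (hfin : ∀ n, Finite (Φ.I n)) {a t : ℝ}
    (ha : Tendsto (fun n : ℕ => Real.log (Nat.card (Word Φ.I 0 n)) / (n : ℝ) ^ 2) atTop
      (𝓝 (a / 2))) (ht : a < t * b) :
    ∀ᶠ n in atTop, (Nat.card (Word Φ.I 0 n) : ℝ) * M n ^ t ≤ 1 := by
  have h1 := ha.add (h.tendsto_upper.const_mul t)
  filter_upwards [h1.eventually_lt_const (show a / 2 + t * -(b / 2) < 0 by linarith),
    eventually_gt_atTop 0] with n hn hn0
  have hn2 : (0 : ℝ) < (n : ℝ) ^ 2 := by positivity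
  have hM := h.upper_pos n
  have hc := Φ.card_word_pos hfin n
  rw [← mul_div_assoc, ← add_div, div_lt_iff₀ hn2, zero_mul] at hn
  rw [← Real.log_nonpos_iff (by positivity), Real.log_mul hc.ne' (by positivity),
    Real.log_rpow hM]
  exact hn.le

/-- Quadratic growth of the exponent beats the linear one; comparing with exp n instead of 1 makes
the lower pressure at least 1, hence strictly positive. -/
theorem HasScales.eventually_exp_le_card_mul (h : Φ.HasScales b m M)
    (hfin : ∀ n, Finite (Φ.I n)) {a t : ℝ}
    (ha : Tendsto (fun n : ℕ => Real.log (Nat.card (Word Φ.I 0 n)) / (n : ℝ) ^ 2) atTop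
      (𝓝 (a / 2))) (ht : t * b < a) :
    ∀ᶠ n : ℕ in atTop, Real.exp n ≤ (Nat.card (Word Φ.I 0 n) : ℝ) * m n ^ t := by
  have h1 := (ha.add (h.tendsto_lower.const_mul t)).sub
    (tendsto_inv_atTop_nhds_zero_nat (𝕜 := ℝ))
  filter_upwards [h1.eventually_const_lt (show 0 < a / 2 + t * -(b / 2) - 0 by linarith),
    eventually_gt_atTop 0] with n hn hn0
  have hn1 : (n : ℝ) ≠ 0 := by positivity
  have hn2 : (0 : ℝ) < (n : ℝ) ^ 2 := by positivity
  have hm := h.pos n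
  have hc := Φ.card_word_pos hfin n
  have : (n : ℝ)⁻¹ = n / (n : ℝ) ^ 2 := by field_simp
  rw [this, ← mul_div_assoc, ← add_div, ← sub_div, lt_div_iff₀ hn2, zero_mul] at hn
  rw [← Real.le_log_iff_exp_le (by positivity), Real.log_mul hc.ne' (by positivity),
    Real.log_rpow hm]
  linarith

theorem HasScales.Z_le (h : Φ.HasScales b m M) (hX : X.Nonempty) (hfin : ∀ n, Finite (Φ.I n))
    (n : ℕ) (t : ℝ≥0) :
    Φ.Z n t ≤ ENNReal.ofReal ((Nat.card (Word Φ.I 0 n) : ℝ) * M n ^ (t : ℝ)) := by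
  have := Fintype.ofFinite (Word Φ.I 0 n)
  rw [Z, tsum_fintype, ENNReal.ofReal_mul (by positivity), ENNReal.ofReal_natCast,
    Nat.card_eq_fintype_card, ← nsmul_eq_mul]
  refine Finset.sum_le_card_nsmul _ _ _ fun ω _ => ENNReal.ofReal_le_ofReal ?_
  have h1 := h.derivNorm_mem_Icc hX n ω
  exact Real.rpow_le_rpow ((h.pos n).le.trans h1.1) h1.2 t.2

theorem HasScales.le_Z (h : Φ.HasScales b m M) (hX : X.Nonempty) (hfin : ∀ n, Finite (Φ.I n))
    (n : ℕ) (t : ℝ≥0) :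
    ENNReal.ofReal ((Nat.card (Word Φ.I 0 n) : ℝ) * m n ^ (t : ℝ)) ≤ Φ.Z n t := by
  have := Fintype.ofFinite (Word Φ.I 0 n)
  rw [Z, tsum_fintype, ENNReal.ofReal_mul (by positivity), ENNReal.ofReal_natCast,
    Nat.card_eq_fintype_card, ← nsmul_eq_mul]
  refine Finset.card_nsmul_le_sum _ _ _ fun ω _ => ENNReal.ofReal_le_ofReal ?_
  have h1 := h.derivNorm_mem_Icc hX n ω
  exact Real.rpow_le_rpow (h.pos n).le h1.1 t.2

theorem HasScales.lowerPressure_nonpos (h : Φ.HasScales b m M) (hX : X.Nonempty)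
    (hfin : ∀ n, Finite (Φ.I n)) {a : ℝ} {t : ℝ≥0}
    (ha : Tendsto (fun n : ℕ => Real.log (Nat.card (Word Φ.I 0 n)) / (n : ℝ) ^ 2) atTop
      (𝓝 (a / 2))) (ht : a < t * b) : Φ.lowerPressure t ≤ 0 := by
  refine liminf_le_of_frequently_le' (Eventually.frequently ?_)
  filter_upwards [h.eventually_card_mul_le_one hfin ha ht] with n hn
  have h1 : Φ.Z n t ≤ 1 := (h.Z_le hX hfin n t).trans (ENNReal.ofReal_le_one.2 hn)
  have h2 : ENNReal.log (Φ.Z n t) ≤ 0 := by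
    rw [← ENNReal.log_one]
    exact ENNReal.log_monotone h1
  exact EReal.div_nonpos_of_nonpos_of_nonneg h2 (Nat.cast_nonneg' n)

theorem HasScales.lowerPressure_pos (h : Φ.HasScales b m M) (hX : X.Nonempty)
    (hfin : ∀ n, Finite (Φ.I n)) {a : ℝ} {t : ℝ≥0}
    (ha : Tendsto (fun n : ℕ => Real.log (Nat.card (Word Φ.I 0 n)) / (n : ℝ) ^ 2) atTop
      (𝓝 (a / 2))) (ht : t * b < a) : 0 < Φ.lowerPressure t := by
  refine zero_lt_one.trans_le (le_liminf_of_le (by isBoundedDefault) ?_)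
  filter_upwards [h.eventually_exp_le_card_mul hfin ha ht, eventually_gt_atTop 0] with n hn hn0
  have h1 : ENNReal.ofReal (Real.exp n) ≤ Φ.Z n t :=
    (ENNReal.ofReal_le_ofReal hn).trans (h.le_Z hX hfin n t)
  have h2 : (n : EReal) ≤ ENNReal.log (Φ.Z n t) := by
    refine le_trans (le_of_eq ?_) (ENNReal.log_monotone h1)
    rw [ENNReal.log_ofReal_of_pos (Real.exp_pos _), Real.log_exp]
    rfl
  rw [EReal.le_div_iff_mul_le (by exact_mod_cast hn0) (EReal.natCast_ne_top n), one_mul]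
  exact h2

theorem HasScales.bowenDim_eq (h : Φ.HasScales b m M) (hb : 0 < b) (hX : X.Nonempty)
    (hfin : ∀ n, Finite (Φ.I n)) {a : ℝ}
    (ha : Tendsto (fun n : ℕ => Real.log (Nat.card (Word Φ.I 0 n)) / (n : ℝ) ^ 2) atTop
      (𝓝 (a / 2))) : Φ.bowenDim = ENNReal.ofReal (a / b) := by
  refine le_antisymm (iSup₂_le fun t ht => ?_) (ENNReal.le_of_forall_nnreal_lt fun t ht => ?_)
  · by_contra! hlt
    rw [← ENNReal.ofReal_coe_nnreal] at hlt
    replace hlt := (div_lt_iff₀ hb).1 (ENNReal.ofReal_lt_ofReal_iff'.1 hlt).1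
    exact (h.lowerPressure_nonpos hX hfin ha hlt).not_gt ht
  · rw [← ENNReal.ofReal_coe_nnreal] at ht
    replace ht := (lt_div_iff₀ hb).1 (ENNReal.ofReal_lt_ofReal_iff'.1 ht).1
    exact le_iSup₂_of_le t (h.lowerPressure_pos hX hfin ha ht) le_rfl

/-! ### Upper bound for the Hausdorff dimension -/

open MeasureTheory in
theorem HasScales.dimH_limitSet_le (h : Φ.HasScales b m M) (hb : 0 < b) (hX : IsCompact X)
    (hfin : ∀ n, Finite (Φ.I n)) {a : ℝ}
    (ha : Tendsto (fun n : ℕ => Real.log (Nat.card (Word Φ.I 0 n)) / (n : ℝ) ^ 2) atTop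
      (𝓝 (a / 2))) : dimH Φ.limitSet ≤ ENNReal.ofReal (a / b) := by
  obtain ⟨C, hC, hdist⟩ := h.exists_dist_le hX
  by_contra! hlt
  obtain ⟨t, ht1, ht2⟩ := ENNReal.lt_iff_exists_nnreal_btwn.1 hlt
  rw [← ENNReal.ofReal_coe_nnreal] at ht1
  replace ht1 := (div_lt_iff₀ hb).1 (ENNReal.ofReal_lt_ofReal_iff'.1 ht1).1
  refine ht2.not_ge (dimH_le_of_hausdorffMeasure_ne_top (ne_top_of_le_ne_top
    (ENNReal.ofReal_ne_top (r := C ^ (t : ℝ))) ?_))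
  have := fun n => Fintype.ofFinite (Word Φ.I 0 n)
  have hdiam : ∀ n (ω : Word Φ.I 0 n),
      Metric.ediam (wordMap Φ.map 0 n ω '' X) ≤ ENNReal.ofReal (C * M n) := by
    intro n ω
    refine Metric.ediam_le ?_
    rintro _ ⟨x, hx, rfl⟩ _ ⟨y, hy, rfl⟩
    exact (edist_le_ofReal (mul_pos hC (h.upper_pos n)).le).2 (hdist n ω x hx y hy)
  refine (Measure.hausdorffMeasure_le_liminf_sum (l := atTop) (t : ℝ) Φ.limitSet
    (fun n => ENNReal.ofReal (C * M n)) ?_ (fun n ω => wordMap Φ.map 0 n ω '' X)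
    (Eventually.of_forall hdiam) ?_).trans ?_
  · have := ENNReal.tendsto_ofReal ((h.tendsto_upper_zero hb).const_mul C)
    rwa [mul_zero, ENNReal.ofReal_zero] at this
  · filter_upwards [eventually_ge_atTop 1] with n hn
    exact Set.iInter₂_subset n hn
  · refine liminf_le_of_frequently_le' (Eventually.frequently ?_)
    filter_upwards [h.eventually_card_mul_le_one hfin ha ht1] with n hn
    have hM := h.upper_pos n
    calc _ ≤ Finset.univ.card • ENNReal.ofReal (C * M n) ^ (t : ℝ) :=
          Finset.sum_le_card_nsmul _ _ _ fun ω _ => ENNReal.rpow_le_rpow (hdiam n ω) t.2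
      _ = ENNReal.ofReal (Nat.card (Word Φ.I 0 n) * (C * M n) ^ (t : ℝ)) := by
          rw [nsmul_eq_mul, ENNReal.ofReal_rpow_of_pos (by positivity),
            ENNReal.ofReal_mul (Nat.cast_nonneg _), ENNReal.ofReal_natCast,
            Nat.card_eq_fintype_card, Finset.card_univ]
      _ ≤ _ := by
          refine ENNReal.ofReal_le_ofReal ?_
          rw [Real.mul_rpow hC.le hM.le, mul_left_comm]
          exact mul_le_of_le_one_right (by positivity) hn

end NCIFS

/-! ### Cylinder masses of the uniform Bernoulli measure -/

open MeasureTheory ProbabilityTheory in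
theorem infinitePi_uniformOn_prefix {J : ℕ → Type u} [∀ k, MeasurableSpace (J k)]
    [∀ k, MeasurableSingletonClass (J k)] [∀ k, Finite (J k)] [∀ k, Nonempty (J k)] (n : ℕ)
    (ω : (k : Fin n) → J k) :
    Measure.infinitePi (fun k => uniformOn (Set.univ : Set (J k))) {w | ∀ k : Fin n, w k = ω k} =
      (Nat.card ((k : Fin n) → J k) : ℝ≥0∞)⁻¹ := by
  let w₀ : ∀ k, J k := fun k => if hk : k < n then ω ⟨k, hk⟩ else Classical.arbitrary _
  have hset : {w : ∀ k, J k | ∀ k : Fin n, w k = ω k} =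
      Set.pi (Finset.range n) fun k => {w₀ k} := by
    ext w
    simp only [Set.mem_ofPred_eq, Set.mem_pi, Finset.coe_range, Set.mem_Iio, Set.mem_singleton_iff]
    constructor
    · intro h k hk
      simpa [w₀, hk] using h ⟨k, hk⟩
    · intro h k
      simpa [w₀] using h k k.2
  rw [hset, Measure.infinitePi_pi _ fun k _ => measurableSet_singleton _, Nat.card_pi,
    Fin.prod_univ_eq_prod_range (fun k => Nat.card (J k)), Nat.cast_prod,
    ENNReal.prod_inv_distrib (fun _ _ _ _ _ => Or.inr (ENNReal.natCast_ne_top _))]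
  refine Finset.prod_congr rfl fun k _ => ?_
  have := Fintype.ofFinite (J k)
  rw [uniformOn_univ, Measure.count_singleton, Nat.card_eq_fintype_card, one_div]

open MeasureTheory ProbabilityTheory in
theorem infinitePi_uniformOn_prefix_mem_le {J : ℕ → Type u} [∀ k, MeasurableSpace (J k)]
    [∀ k, MeasurableSingletonClass (J k)] [∀ k, Finite (J k)] [∀ k, Nonempty (J k)] (n : ℕ)
    (A : Set ((k : Fin n) → J k)) :
    Measure.infinitePi (fun k => uniformOn (Set.univ : Set (J k)))
        {w | (fun k : Fin n => w k) ∈ A} ≤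
      A.ncard * (Nat.card ((k : Fin n) → J k) : ℝ≥0∞)⁻¹ := by
  have hA : A.Finite := A.toFinite
  have hsub : {w : ∀ k, J k | (fun k : Fin n => w k) ∈ A} ⊆
      ⋃ ω ∈ hA.toFinset, {w | ∀ k : Fin n, w k = ω k} := by
    intro w hw
    simp only [Set.mem_iUnion]
    exact ⟨_, hA.mem_toFinset.2 hw, fun _ => rfl⟩
  refine (measure_mono hsub).trans ((measure_biUnion_finset_le _ _).trans ?_)
  simp_rw [infinitePi_uniformOn_prefix]
  rw [Finset.sum_const, nsmul_eq_mul, Set.ncard_eq_toFinset_card A hA]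

/-! ### Lower bound for the Hausdorff dimension -/

namespace NCIFS

variable {d : ℕ} {X : Set (EuclideanSpace ℝ (Fin d))} {Φ : NCIFS.{u} X} {b : ℝ} {m M : ℕ → ℝ}

theorem isClosed_limitSet (Φ : NCIFS.{u} X) (hX : IsCompact X) (hfin : ∀ n, Finite (Φ.I n)) :
    IsClosed Φ.limitSet :=
  isClosed_biInter fun n _ => isClosed_iUnion_of_finite fun ω =>
    (hX.image_of_continuousOn ((Φ.wordMap_continuousOn 0 n ω).mono Φ.subset_V)).isClosed

theorem exists_forall_mem_image_wordMap (Φ : NCIFS.{u} X) (hX : X.Nonempty) (hXc : IsCompact X)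
    (w : ∀ k, Φ.I (0 + k)) :
    ∃ p, ∀ n, p ∈ wordMap Φ.map 0 n (fun k => w k) '' X := by
  have hcpt : ∀ n, IsCompact (wordMap Φ.map 0 n (fun k => w k) '' X) := fun n =>
    hXc.image_of_continuousOn ((Φ.wordMap_continuousOn 0 n _).mono Φ.subset_V)
  have := IsCompact.nonempty_iInter_of_sequence_nonempty_isCompact_isClosed
    (fun n => wordMap Φ.map 0 n (fun k => w k) '' X) (fun n => ?_) (fun n => hX.image _)
    (hcpt 0) (fun n => (hcpt n).isClosed)
  · obtain ⟨p, hp⟩ := this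
    exact ⟨p, Set.mem_iInter.1 hp⟩
  · simp only [wordMap, Set.image_comp]
    exact Set.image_mono (Φ.mapsTo _ _).image_subset

/-- After taking logarithms and dividing by n², the left side tends to -a/2 and the right side to -t
b/2, because m n and M n, and likewise M (n + 1) and M n, have the same quadratic rate. -/
theorem HasScales.eventually_card_bound_le (h : Φ.HasScales b m M)
    (hfin : ∀ n, Finite (Φ.I n)) {a t Q : ℝ} (hQ : 0 < Q)
    (ha : Tendsto (fun n : ℕ => Real.log (Nat.card (Word Φ.I 0 n)) / (n : ℝ) ^ 2) atTop
      (𝓝 (a / 2))) (ht : t * b < a) :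
    ∀ᶠ n in atTop, Q * (M n / m n) ^ d / Nat.card (Word Φ.I 0 n) ≤ M (n + 1) ^ t := by
  have hinv : Tendsto (fun n : ℕ => (n : ℝ)⁻¹) atTop (𝓝 0) := tendsto_inv_atTop_nhds_zero_nat
  have hQlim : Tendsto (fun n : ℕ => Real.log Q * ((n : ℝ)⁻¹) ^ 2) atTop (𝓝 0) := by
    simpa using (hinv.pow 2).const_mul (Real.log Q)
  have hshift : Tendsto (fun n : ℕ => Real.log (M (n + 1)) / (n : ℝ) ^ 2) atTop
      (𝓝 (-(b / 2))) := by
    have h1 := (h.tendsto_upper.comp (tendsto_add_atTop_nat 1)).mul ((hinv.const_add 1).pow 2)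
    rw [add_zero, one_pow, mul_one] at h1
    refine h1.congr' ?_
    filter_upwards [eventually_gt_atTop 0] with n hn
    have hn1 : (n : ℝ) ≠ 0 := by positivity
    simp only [Function.comp, Nat.cast_add, Nat.cast_one]
    field_simp
  have hlim := ((hQlim.add ((h.tendsto_upper.sub h.tendsto_lower).const_mul (d : ℝ))).sub ha).sub
    (hshift.const_mul t)
  filter_upwards [hlim.eventually_lt_const
    (show 0 + (d : ℝ) * (-(b / 2) - -(b / 2)) - a / 2 - t * -(b / 2) < 0 by linarith),
    eventually_gt_atTop 0] with n hn hn0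
  have hM := h.upper_pos n
  have hM' := h.upper_pos (n + 1)
  have hm := h.pos n
  have hc := Φ.card_word_pos hfin n
  have hn2 : (0 : ℝ) < (n : ℝ) ^ 2 := by positivity
  rw [← Real.log_le_log_iff (by positivity) (by positivity), Real.log_rpow hM',
    Real.log_div (by positivity) hc.ne', Real.log_mul hQ.ne' (by positivity), Real.log_pow,
    Real.log_div hM.ne' hm.ne']
  have h2 : Real.log Q * ((n : ℝ)⁻¹) ^ 2 +
      d * (Real.log (M n) / (n : ℝ) ^ 2 - Real.log (m n) / (n : ℝ) ^ 2) -
      Real.log (Nat.card (Word Φ.I 0 n)) / (n : ℝ) ^ 2 -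
      t * (Real.log (M (n + 1)) / (n : ℝ) ^ 2) =
      (Real.log Q + d * (Real.log (M n) - Real.log (m n)) -
        Real.log (Nat.card (Word Φ.I 0 n)) - t * Real.log (M (n + 1))) / (n : ℝ) ^ 2 := by
    field_simp
  rw [h2, div_lt_iff₀ hn2, zero_mul] at hn
  linarith

open MeasureTheory ProbabilityTheory in
/-- The image of the uniform Bernoulli measure under the coding map. -/
theorem HasScales.exists_measure (h : Φ.HasScales b m M) (hb : 0 < b) (hX : X.Nonempty)
    (hXc : IsCompact X) (hfin : ∀ n, Finite (Φ.I n)) :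
    ∃ ν : Measure (EuclideanSpace ℝ (Fin d)), ν Φ.limitSet = 1 ∧
      ∀ n s, ν s ≤ Set.ncard {ω : Word Φ.I 0 n | (wordMap Φ.map 0 n ω '' X ∩ closure s).Nonempty} *
        (Nat.card (Word Φ.I 0 n) : ℝ≥0∞)⁻¹ := by
  have hne := Φ.nonempty
  let _ : ∀ k, MeasurableSpace (Φ.I (0 + k)) := fun _ => ⊤
  have : ∀ k, MeasurableSingletonClass (Φ.I (0 + k)) := fun k => ⟨fun _ => trivial⟩
  obtain ⟨C, hC, hdist⟩ := h.exists_dist_le hXc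
  choose p hp using Φ.exists_forall_mem_image_wordMap hX hXc
  obtain ⟨x₀, hx₀⟩ := hX
  have hpm : Measurable p := by
    -- The coding map is a pointwise limit of maps depending on finitely many letters.
    refine measurable_of_tendsto_metrizable
      (f := fun (n : ℕ) w => wordMap Φ.map 0 n (fun k => w k) x₀) (fun n => ?_)
      (tendsto_pi_nhds.2 fun w => ?_)
    · have h1 : Measurable fun ω : ((k : Fin n) → Φ.I (0 + k)) => wordMap Φ.map 0 n ω x₀ :=
        measurable_of_finite _
      exact h1.comp (measurable_pi_lambda _ fun k => measurable_pi_apply _)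
    · refine tendsto_iff_dist_tendsto_zero.2 (squeeze_zero (fun _ => dist_nonneg) (fun n => ?_)
        (by simpa using (h.tendsto_upper_zero hb).const_mul C))
      obtain ⟨y, hy, hyp⟩ := hp w n
      rw [← hyp]
      exact hdist n _ x₀ hx₀ y hy
  refine ⟨(Measure.infinitePi fun k => uniformOn (Set.univ : Set (Φ.I (0 + k)))).map p, ?_,
    fun n s => ?_⟩
  · rw [Measure.map_apply hpm (Φ.isClosed_limitSet hXc hfin).measurableSet]
    have : p ⁻¹' Φ.limitSet = Set.univ := Set.eq_univ_of_forall fun w =>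
      Set.mem_iInter₂.2 fun n _ => Set.mem_iUnion.2 ⟨fun k => w k, hp w n⟩
    rw [this, measure_univ]
  -- Passing to the closure makes the set measurable without changing its diameter.
  · refine (measure_mono subset_closure).trans ?_
    rw [Measure.map_apply hpm isClosed_closure.measurableSet]
    refine le_trans (measure_mono fun w hw => ?_)
      (infinitePi_uniformOn_prefix_mem_le (J := fun k => Φ.I (0 + k)) n _)
    exact ⟨p w, hp w n, hw⟩

open MeasureTheory in
theorem HasScales.le_dimH_limitSet (h : Φ.HasScales b m M) (hd : 1 ≤ d) (hb : 0 < b)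
    (hX : IsPhaseSpace X) (hfin : ∀ n, Finite (Φ.I n)) {a : ℝ}
    (ha : Tendsto (fun n : ℕ => Real.log (Nat.card (Word Φ.I 0 n)) / (n : ℝ) ^ 2) atTop
      (𝓝 (a / 2))) : ENNReal.ofReal (a / b) ≤ dimH Φ.limitSet := by
  obtain ⟨Q, hQ, hcard⟩ := h.exists_card_le hd hX hfin
  obtain ⟨ν, hν1, hν⟩ := h.exists_measure hb hX.nonempty hX.isCompact hfin
  refine ENNReal.le_of_forall_nnreal_lt fun t ht => ?_
  rcases eq_zero_or_pos t with rfl | ht0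
  · simp
  rw [← ENNReal.ofReal_coe_nnreal] at ht
  replace ht := (lt_div_iff₀ hb).1 (ENNReal.ofReal_lt_ofReal_iff'.1 ht).1
  have hball : ∀ n s, Metric.ediam s ≤ ENNReal.ofReal (M n) →
      ν s ≤ ENNReal.ofReal (Q * (M n / m n) ^ d / Nat.card (Word Φ.I 0 n)) := by
    intro n s hs
    refine (hν n s).trans ?_
    rw [div_eq_mul_inv, ENNReal.ofReal_mul' (by positivity),
      ENNReal.ofReal_inv_of_pos (Φ.card_word_pos hfin n), ENNReal.ofReal_natCast]
    gcongr
    rw [← ENNReal.ofReal_natCast]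
    exact ENNReal.ofReal_le_ofReal (hcard n _ (by rwa [Metric.ediam_closure]))
  obtain ⟨n₀, hn₀⟩ := eventually_atTop.1 (h.eventually_card_bound_le hfin hQ ha ht)
  have hnext : ∀ n ≥ n₀, ∀ s, Metric.ediam s ≤ ENNReal.ofReal (M n) →
      ν s ≤ ENNReal.ofReal (M (n + 1)) ^ (t : ℝ) := fun n hn s hs => by
    rw [ENNReal.ofReal_rpow_of_pos (h.upper_pos _)]
    exact (hball n s hs).trans (ENNReal.ofReal_le_ofReal (hn₀ n hn))
  have hM0 : Tendsto (fun n => ENNReal.ofReal (M n)) atTop (𝓝 0) := by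
    simpa using ENNReal.tendsto_ofReal (h.tendsto_upper_zero hb)
  -- `M` need not be monotone. A diameter at most the smallest of M 0, …, M n₀ ensures that the
  -- first scale below it has index greater than n₀.
  obtain ⟨k₀, -, hk₀⟩ := (Finset.range (n₀ + 1)).exists_min_image M ⟨0, by simp⟩
  have hle : ν ≤ μH[t] := by
    refine Measure.le_hausdorffMeasure _ ν (ENNReal.ofReal (M k₀))
      (ENNReal.ofReal_pos.2 (h.upper_pos _)) fun s hs => ?_
    -- With diameter zero no scale lies below, but the mass bound holds at every large level and
    -- tends to 0 since t > 0.
    rcases eq_or_ne (Metric.ediam s) 0 with h0 | h0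
    · have hlim := ((ENNReal.continuous_rpow_const (y := (t : ℝ))).tendsto 0).comp
        (hM0.comp (tendsto_add_atTop_nat 1))
      rw [ENNReal.zero_rpow_of_pos (by exact_mod_cast ht0)] at hlim
      refine (ge_of_tendsto hlim ?_).trans (zero_le)
      filter_upwards [eventually_ge_atTop n₀] with n hn
      exact hnext n hn s (by simp [h0])
    · have hex : ∃ n, ENNReal.ofReal (M n) < Metric.ediam s :=
        (hM0.eventually_lt_const (pos_iff_ne_zero.2 h0)).exists
      -- The least N with M N below the diameter places the diameter between M N and M (N - 1).
      classical
      have hN := Nat.find_spec hex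
      have hmin : ∀ k < Nat.find hex, Metric.ediam s ≤ ENNReal.ofReal (M k) := fun k hk =>
        not_lt.1 (Nat.find_min hex hk)
      generalize Nat.find hex = N at hN hmin
      have hNn : n₀ < N := by
        by_contra! hlt
        exact (hs.trans (ENNReal.ofReal_le_ofReal
          (hk₀ N (Finset.mem_range.2 (Nat.lt_succ_of_le hlt))))).not_gt hN
      obtain ⟨n, rfl⟩ : ∃ n, N = n + 1 := ⟨N - 1, by omega⟩
      exact (hnext n (by omega) s (hmin n (by omega))).trans (ENNReal.rpow_le_rpow hN.le t.2)
  refine le_dimH_of_hausdorffMeasure_ne_zero (ne_of_gt ?_)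
  refine lt_of_lt_of_le ?_ (hle Φ.limitSet)
  rw [hν1]
  exact one_pos

end NCIFS

theorem proposition1p3 {d : ℕ} (hd : 1 ≤ d) {X : Set (EuclideanSpace ℝ (Fin d))}
    (hX : IsPhaseSpace X) (Φ : NCIFS.{u} X) (hfin : ∀ n, Finite (Φ.I n))
    (a b : ℝ) (ha : 0 < a) (hb : 0 < b)
    (hlim_a : Tendsto (fun n : ℕ => 1 / ((n : ℝ) + 1) * Real.log (Nat.card (Φ.I n)))
      atTop (𝓝 a))
    (hlim_b : ∀ ε : ℝ, 0 < ε → ∃ N : ℕ, ∀ n, N ≤ n → ∀ j : Φ.I n,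
      |1 / ((n : ℝ) + 1) * Real.log (1 / derivNorm X (Φ.map n j)) - b| < ε) :
    Φ.bowenDim = ENNReal.ofReal (a / b) ∧ dimH Φ.limitSet = ENNReal.ofReal (a / b) := by
  obtain ⟨m, M, h⟩ := Φ.exists_hasScales hd hX.nonempty hfin hlim_b
  have hcard := Φ.tendsto_log_card_word hfin hlim_a
  exact ⟨h.bowenDim_eq hb hX.nonempty hfin hcard,
    le_antisymm (h.dimH_limitSet_le hb hX.isCompact hfin hcard)
      (h.le_dimH_limitSet hd hb hX hfin hcard)⟩
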